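/- For every integer $n \ge 1$ and every prime $p$ there exists a finite group $G$ that satisfies the following conditions: (i) $G = H \ltimes M$ is a semidirect product of a cyclic group $H$ of order $p^n$ acting faithfully on a finite group $M$; (ii) $M$ is a solvable group of order prime to $p$ whose Fitting height is $n$; (iii) the Fitting subgroup of $M$ is a minimal normal subgroup of $G$; (iv) for every nonidentity element $x \in M$, $p$ divides $|G : C_G(x)|$. Here the Fitting subgroup $F(X)$ of a finite group $X$ is the subgroup generated by all nilpotent normal subgroups of $X$, and the Fitting height of a finite solvable group $X$ is the least $k$ with $F_k = X$, where $F_0 = 1$ and $F_{i+1}/F_i = F(X/F_i)$ for $i \ge 0$. A minimal normal subgroup of $G$ is a nontrivial normal subgroup of $G$ that contains no normal subgroups of $G$ other than $1$ and itself. -/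

import Mathlib

/-- The Fitting subgroup of `G`: the subgroup generated by all nilpotent normal subgroups. -/
def fittingSubgroup (G : Type*) [Group G] : Subgroup G :=
  sSup {N : Subgroup G | N.Normal ∧ Group.IsNilpotent N}

theorem fittingSubgroup_normal (G : Type*) [Group G] : (fittingSubgroup G).Normal :=
  Subgroup.sSup_normal _ fun _ h => h.1

/-- The terms `F 0 = 1`, `F (k + 1) / F k = Fitting subgroup of G / F k` of the upper Fitting
series, bundled with their normality. -/
def fittingSeriesAux (G : Type*) [Group G] : ℕ → {N : Subgroup G // N.Normal}
  | 0 => ⟨⊥, inferInstance⟩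
  | k + 1 =>
    let F := fittingSeriesAux G k
    haveI : F.1.Normal := F.2
    ⟨(fittingSubgroup (G ⧸ F.1)).comap (QuotientGroup.mk' F.1),
      (fittingSubgroup_normal (G ⧸ F.1)).comap _⟩

/-- The upper Fitting series of `G`. -/
def fittingSeries (G : Type*) [Group G] (k : ℕ) : Subgroup G :=
  (fittingSeriesAux G k).1

/-- `G` has Fitting height `n`: the upper Fitting series reaches `G` at step `n` and not before. -/
def HasFittingHeight (G : Type*) [Group G] (n : ℕ) : Prop :=
  IsLeast {k : ℕ | fittingSeries G k = ⊤} n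

/-- `N` is a minimal normal subgroup of `G`. -/
def IsMinimalNormal {G : Type*} [Group G] (N : Subgroup G) : Prop :=
  N.Normal ∧ N ≠ ⊥ ∧ ∀ K : Subgroup G, K.Normal → K ≤ N → K = ⊥ ∨ K = N

open SemidirectProduct
open scoped commutatorElement

/-! ### The upper Fitting series and quotients. -/

section Fitting

/-! Induct on n, carrying a `p'`-group M with a fixed-point-free automorphism σ of order p^n, such
that every nontrivial σ-invariant normal subgroup contains F(M); take H = ⟨σ⟩. The next group is V ⋊
M, for V a faithful module over 𝔽_q with q a new prime, irreducible under M together with an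
operator τ compatible with σ. Faithfulness and coprimality make V the Fitting subgroup, so the
height rises by one; irreducibility gives the containment property.

V is found inside the functions M × ℤ/p^(n+1) → 𝔽_q. There T = τ^(p^n) commutes with M, and V is
chosen where the sums over ⟨T⟩ and over F(M) both vanish. The first condition removes fixed vectors
of T, so the new automorphism is fixed-point-free of order p^(n+1). The second forbids F(M) from
acting trivially, so by the containment property the kernel on V is trivial.

Condition (iv) follows by counting: a fixed point of H on the conjugacy class of x would be a
nontrivial element of M fixed by σ. -/

theorem fittingSubgroup_le_comap {X Y : Type*} [Group X] [Group Y] (e : X ≃* Y) :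
    fittingSubgroup X ≤ (fittingSubgroup Y).comap e.toMonoidHom := by
  refine sSup_le fun N hN => ?_
  rw [← Subgroup.map_le_iff_le_comap]
  refine le_sSup ⟨hN.1.map _ e.surjective, ?_⟩
  have := hN.2
  exact Group.nilpotent_of_surjective (e.toMonoidHom.subgroupMap N)
    (e.toMonoidHom.subgroupMap_surjective N)

theorem fittingSubgroup_comap_equiv {X Y : Type*} [Group X] [Group Y] (e : X ≃* Y) :
    (fittingSubgroup Y).comap e.toMonoidHom = fittingSubgroup X := by
  refine le_antisymm (fun x hx => ?_) (fittingSubgroup_le_comap e)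
  have := fittingSubgroup_le_comap e.symm hx
  simpa using this

instance fittingSeries_normal (X : Type*) [Group X] (k : ℕ) : (fittingSeries X k).Normal :=
  (fittingSeriesAux X k).2

theorem fittingSeries_zero (X : Type*) [Group X] : fittingSeries X 0 = ⊥ := rfl

theorem fittingSeries_succ (X : Type*) [Group X] (k : ℕ) :
    fittingSeries X (k + 1) =
      (fittingSubgroup (X ⧸ fittingSeries X k)).comap (QuotientGroup.mk' (fittingSeries X k)) :=
  rfl

theorem fittingSeries_succ_eq_comap {X Y : Type*} [Group X] [Group Y] (k : ℕ) (f : X →* Y)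
    (hf : Function.Surjective f) (hk : f.ker = fittingSeries X k) :
    fittingSeries X (k + 1) = (fittingSubgroup Y).comap f := by
  rw [fittingSeries_succ]
  let e : X ⧸ fittingSeries X k ≃* Y :=
    (QuotientGroup.quotientMulEquivOfEq hk.symm).trans
      (QuotientGroup.quotientKerEquivOfSurjective f hf)
  rw [← fittingSubgroup_comap_equiv e, Subgroup.comap_comap]
  rfl

theorem fittingSeries_succ_of_ker_eq {X Y : Type*} [Group X] [Group Y] (π : X →* Y)
    (hπ : Function.Surjective π) (hker : π.ker = fittingSubgroup X) (k : ℕ) :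
    fittingSeries X (k + 1) = (fittingSeries Y k).comap π := by
  induction k with
  | zero =>
    rw [fittingSeries_succ_eq_comap 0 (MonoidHom.id X) Function.surjective_id (by
      simp [fittingSeries_zero]), fittingSeries_zero, MonoidHom.comap_bot, hker]
    rfl
  | succ k ih =>
    rw [fittingSeries_succ_eq_comap (k + 1) ((QuotientGroup.mk' (fittingSeries Y k)).comp π)
      ((QuotientGroup.mk'_surjective _).comp hπ) (by
        rw [ih, ← MonoidHom.comap_ker, QuotientGroup.ker_mk']), fittingSeries_succ,
      Subgroup.comap_comap]

/-- Dividing by the Fitting subgroup shifts the series down by one index; nontriviality of `X`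
excludes height 0. -/
theorem HasFittingHeight.succ_of_ker_eq {X Y : Type*} [Group X] [Group Y] [Nontrivial X]
    (π : X →* Y) (hπ : Function.Surjective π) (hker : π.ker = fittingSubgroup X) {n : ℕ}
    (h : HasFittingHeight Y n) : HasFittingHeight X (n + 1) := by
  constructor
  · have h1 : fittingSeries Y n = ⊤ := h.1
    simp [fittingSeries_succ_of_ker_eq π hπ hker, h1]
  · rintro (_ | k) hk
    · exact absurd hk (bot_ne_top (α := Subgroup X))
    · refine Nat.succ_le_succ (h.2 ?_)
      have hk' : fittingSeries X (k + 1) = ⊤ := hk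
      rw [fittingSeries_succ_of_ker_eq π hπ hker] at hk'
      refine (Subgroup.comap_injective hπ) ?_
      rw [hk', Subgroup.comap_top]

end Fitting

/-! ### Split extensions by modules and their Fitting subgroup. -/

section ModuleExtension

/-- An element of multiplicative order prime to `q` in a ring of characteristic `q` is trivial
when it is unipotent. -/
theorem eq_one_of_unipotent_of_pow_eq_one {R : Type*} [Ring R] (q : ℕ) [Fact q.Prime] [CharP R q]
    {t : R} {k m : ℕ} (hk : (t - 1) ^ k = 0) (hm : t ^ m = 1) (hqm : q.Coprime m) : t = 1 := by
  have h1 : t ^ q ^ k = 1 := by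
    have h2 : (t - 1) ^ q ^ k = 0 :=
      pow_eq_zero_of_le (Nat.lt_pow_self (Fact.out : q.Prime).one_lt).le hk
    rw [sub_pow_char_pow_of_commute q k (Commute.one_right t), one_pow] at h2
    exact sub_eq_zero.mp h2
  have h3 : t ^ Nat.gcd (q ^ k) m = 1 := pow_gcd_eq_one.2 ⟨h1, hm⟩
  rwa [Nat.Coprime.pow_left k hqm, pow_one] at h3

variable {q : ℕ} {V M : Type*} [AddCommGroup V] [Module (ZMod q) V] [Group M]

/-- The action on the multiplicative copy of a module attached to a linear representation. -/
def multiplicativeAut (ρ : M →* (V ≃ₗ[ZMod q] V)) : M →* MulAut (Multiplicative V) where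
  toFun m := AddEquiv.toMultiplicative (ρ m).toAddEquiv
  map_one' := by ext; simp
  map_mul' a b := by ext; simp

@[simp]
theorem multiplicativeAut_apply (ρ : M →* (V ≃ₗ[ZMod q] V)) (m : M) (v : Multiplicative V) :
    multiplicativeAut ρ m v = Multiplicative.ofAdd (ρ m v.toAdd) := rfl

/-- The split extension of a group by a linear representation. -/
abbrev ModuleExtension (ρ : M →* (V ≃ₗ[ZMod q] V)) : Type _ :=
  Multiplicative V ⋊[multiplicativeAut ρ] M

namespace ModuleExtension

variable (ρ : M →* (V ≃ₗ[ZMod q] V))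

/-- The inclusion of the module into the split extension. -/
abbrev incl (v : V) : ModuleExtension ρ := inl (Multiplicative.ofAdd v)

theorem conj_incl (x : ModuleExtension ρ) (v : V) :
    x * incl ρ v * x⁻¹ = incl ρ (ρ x.right v) := by
  have h1 (y : V) : ρ x.right (ρ x.right⁻¹ y) = y := by
    rw [← LinearEquiv.mul_apply, ← map_mul, mul_inv_cancel, map_one, LinearEquiv.coe_one, id]
  ext
  · apply Multiplicative.toAdd.injective
    simp [h1, -map_inv]
  · simp

theorem commutator_incl (x : ModuleExtension ρ) (v : V) :
    ⁅x, incl ρ v⁆ = incl ρ (ρ x.right v - v) := by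
  rw [commutatorElement_def, conj_incl, sub_eq_add_neg, incl, incl, incl, ofAdd_add, map_mul,
    ofAdd_neg, map_inv]

variable {ρ}

theorem incl_eq_one {v : V} : incl ρ v = 1 ↔ v = 0 := by
  rw [incl, ← map_one inl, inl_inj, ofAdd_eq_one]

/-- An element of a nilpotent normal subgroup acts unipotently on V. Its action also has order prime
to q, so it is trivial, and faithfulness puts the element in V. Conversely V is abelian and normal.
-/
theorem fittingSubgroup_eq [Fact q.Prime] [Finite M] [Nontrivial V] (hρ : Function.Injective ρ)
    (hq : q.Coprime (Nat.card M)) :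
    fittingSubgroup (ModuleExtension ρ) = (rightHom : ModuleExtension ρ →* M).ker := by
  have : CharP (Module.End (ZMod q) V) q :=
    charP_of_injective_algebraMap (algebraMap (ZMod q) (Module.End (ZMod q) V)).injective q
  rw [← range_inl_eq_ker_rightHom]
  apply le_antisymm
  · refine sSup_le fun N ⟨hN, hnil⟩ x hx => ?_
    obtain ⟨k, hk⟩ := (Subgroup.isNilpotent_iff_lowerCentralSeries N).1 hnil
    let t : Module.End (ZMod q) V := (ρ x.right : V ≃ₗ[ZMod q] V).toLinearMap
    -- Iterated commutators with x are powers of t - 1. The vector v need not lie in `N`, but its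
    -- first commutator with x does; hence the exponent j + 1 at term j.
    have hmem : ∀ (j : ℕ) (v : V), incl ρ (((t - 1) ^ (j + 1)) v) ∈ N.lowerCentralSeries j := by
      intro j
      induction j with
      | zero =>
        intro v
        have : incl ρ (((t - 1) ^ (0 + 1) : Module.End (ZMod q) V) v) =
            x * (incl ρ v * x⁻¹ * (incl ρ v)⁻¹) := by
          rw [← mul_assoc, ← mul_assoc, ← commutatorElement_def, commutator_incl]
          simp [t]
        rw [this]
        exact N.mul_mem hx (hN.conj_mem _ (N.inv_mem hx) _)
      | succ j ih =>
        intro v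
        have : incl ρ (((t - 1) ^ (j + 1 + 1)) v) = ⁅x, incl ρ (((t - 1) ^ (j + 1)) v)⁆ := by
          rw [commutator_incl, pow_succ']
          simp [t]
        rw [this, Subgroup.lowerCentralSeries_succ, Subgroup.commutator_comm]
        exact Subgroup.commutator_mem_commutator hx (ih v)
    have hzero : (t - 1) ^ (k + 1) = 0 := by
      ext v
      have := hmem k v
      rw [hk, Subgroup.mem_bot] at this
      exact incl_eq_one.1 this
    have htm : t ^ Nat.card M = 1 := by
      have h1 : (ρ x.right) ^ Nat.card M = 1 := by
        rw [← map_pow, pow_card_eq_one', map_one]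
      ext v
      have h2 := congrArg (fun e : V ≃ₗ[ZMod q] V => e v) h1
      simpa [t, Module.End.pow_apply, LinearEquiv.pow_apply] using h2
    have ht := eq_one_of_unipotent_of_pow_eq_one q hzero htm hq
    have hr : x.right = 1 := by
      apply hρ
      ext v
      simpa [t] using congrArg (fun e : Module.End (ZMod q) V => e v) ht
    exact ⟨x.left, by ext <;> simp [hr]⟩
  · refine le_sSup ⟨?_, ?_⟩
    · rw [range_inl_eq_ker_rightHom]; infer_instance
    · exact Group.nilpotent_of_surjective
        (inl : Multiplicative V →* ModuleExtension ρ).rangeRestrict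
        (MonoidHom.rangeRestrict_surjective _)

end ModuleExtension

end ModuleExtension

/-! ### Fitting towers and their extension by a module. -/

/-- The inductive package: `σ` is a fixed-point-free automorphism of order `p ^ n` of a solvable
`p'`-group of Fitting height `n`, and every nontrivial `σ`-invariant normal subgroup contains the
Fitting subgroup. -/
structure IsFittingTower (p n : ℕ) (M : Type*) [Group M] (σ : MulAut M) : Prop where
  finite : Finite M
  solvable : Group.IsSolvable M
  not_dvd_card : ¬ p ∣ Nat.card M
  orderOf_eq : orderOf σ = p ^ n
  eq_one_of_fixed : ∀ m, σ m = m → m = 1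
  height : HasFittingHeight M n
  le_of_invariant : ∀ K : Subgroup M, K.Normal → (∀ x ∈ K, σ x ∈ K) → K ≠ ⊥ →
    fittingSubgroup M ≤ K
  subsingleton : fittingSubgroup M = ⊥ → Subsingleton M

theorem isFittingTower_zero {p : ℕ} (hp : p.Prime) (M : Type*) [Group M] [Subsingleton M] :
    IsFittingTower p 0 M 1 where
  finite := inferInstance
  solvable := inferInstance
  not_dvd_card := by simpa using hp.ne_one
  orderOf_eq := by simp
  eq_one_of_fixed m _ := Subsingleton.elim _ _
  height := ⟨Subsingleton.elim _ _, fun k _ => Nat.zero_le k⟩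
  le_of_invariant K _ _ h := absurd (Subsingleton.elim _ _) h
  subsingleton _ := inferInstance

namespace ModuleExtension

variable {q : ℕ} {V M : Type*} [AddCommGroup V] [Module (ZMod q) V] [Group M]
variable {ρ : M →* (V ≃ₗ[ZMod q] V)} {σ : MulAut M} {τ : V ≃ₗ[ZMod q] V}

/-- The automorphism of a split extension given by compatible automorphisms of its factors. -/
def aut (h : ∀ m v, τ (ρ m v) = ρ (σ m) (τ v)) : MulAut (ModuleExtension ρ) :=
  SemidirectProduct.congr (AddEquiv.toMultiplicative τ.toAddEquiv) σ (fun m => by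
    ext v
    exact congrArg Multiplicative.ofAdd (h m v.toAdd))

theorem aut_apply (h : ∀ m v, τ (ρ m v) = ρ (σ m) (τ v)) (x : ModuleExtension ρ) :
    aut h x = ⟨Multiplicative.ofAdd (τ x.left.toAdd), σ x.right⟩ := rfl

theorem aut_incl (h : ∀ m v, τ (ρ m v) = ρ (σ m) (τ v)) (v : V) :
    aut h (incl ρ v) = incl ρ (τ v) := by
  rw [aut_apply]
  ext <;> simp

theorem aut_pow_apply (h : ∀ m v, τ (ρ m v) = ρ (σ m) (τ v)) (k : ℕ) (x : ModuleExtension ρ) :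
    (aut h ^ k) x = ⟨Multiplicative.ofAdd ((τ ^ k) x.left.toAdd), (σ ^ k) x.right⟩ := by
  induction k with
  | zero => rfl
  | succ k ih => rw [pow_succ', MulAut.mul_apply, ih, aut_apply, pow_succ', pow_succ']; rfl

/-- K ∩ V is an invariant submodule. If it is zero, then [K, V] ≤ K ∩ V is trivial, so K acts
trivially on V, lies in V by faithfulness, and vanishes. -/
theorem eq_bot_or_ker_le (hρ : Function.Injective ρ) (h : ∀ m v, τ (ρ m v) = ρ (σ m) (τ v))
    (hirr : ∀ W : Submodule (ZMod q) V, (∀ m, ∀ v ∈ W, ρ m v ∈ W) → (∀ v ∈ W, τ v ∈ W) →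
      W = ⊥ ∨ W = ⊤)
    (K : Subgroup (ModuleExtension ρ)) (hK : K.Normal) (hσ : ∀ x ∈ K, aut h x ∈ K) :
    K = ⊥ ∨ (rightHom : ModuleExtension ρ →* M).ker ≤ K := by
  let W : Submodule (ZMod q) V :=
    AddSubgroup.toZModSubmodule q (Subgroup.toAddSubgroup' (K.comap inl))
  have hW : ∀ v, v ∈ W ↔ incl ρ v ∈ K := fun v => Iff.rfl
  have hWρ : ∀ m, ∀ v ∈ W, ρ m v ∈ W := by
    intro m v hv
    have := hK.conj_mem _ ((hW v).1 hv) (inr m)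
    rwa [conj_incl, right_inr] at this
  rcases hirr W hWρ (fun v hv => (hW _).2 (aut_incl h v ▸ hσ _ ((hW v).1 hv))) with h0 | h1
  · left
    rw [Subgroup.eq_bot_iff_forall]
    intro x hx
    have hr : x.right = 1 := by
      apply hρ
      ext v
      have : ρ x.right v - v ∈ W := by
        rw [hW, ← commutator_incl, commutatorElement_def, mul_assoc, mul_assoc]
        refine K.mul_mem hx ?_
        rw [← mul_assoc]
        exact hK.conj_mem _ (K.inv_mem hx) _
      rw [h0, Submodule.mem_bot, sub_eq_zero] at this
      simpa using this
    have hx' : x = incl ρ x.left.toAdd := by ext <;> simp [hr]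
    have : x.left.toAdd ∈ W := by rwa [hW, ← hx']
    rw [h0, Submodule.mem_bot] at this
    rw [hx', incl_eq_one, this]
  · right
    rw [← range_inl_eq_ker_rightHom]
    rintro _ ⟨v, rfl⟩
    have : v.toAdd ∈ W := h1 ▸ Submodule.mem_top
    exact this

theorem isFittingTower_succ {p n : ℕ} [Fact p.Prime] [Fact q.Prime] [Finite V] [Nontrivial V]
    (hM : IsFittingTower p n M σ) (hρ : Function.Injective ρ) (hq : q.Coprime (Nat.card M))
    (hpq : p ≠ q) (h : ∀ m v, τ (ρ m v) = ρ (σ m) (τ v))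
    (hirr : ∀ W : Submodule (ZMod q) V, (∀ m, ∀ v ∈ W, ρ m v ∈ W) → (∀ v ∈ W, τ v ∈ W) →
      W = ⊥ ∨ W = ⊤)
    (hτ : τ ^ p ^ (n + 1) = 1) (hfix : ∀ v, (τ ^ p ^ n) v = v → v = 0) :
    IsFittingTower p (n + 1) (ModuleExtension ρ) (aut h) := by
  have := hM.finite
  have hfinite : Finite (ModuleExtension ρ) := Finite.of_equiv _ equivProd.symm
  have hfit := fittingSubgroup_eq hρ hq
  have hnt : Nontrivial (ModuleExtension ρ) := inl_injective.nontrivial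
  obtain ⟨v₀, hv₀⟩ := exists_ne (0 : V)
  refine ⟨hfinite, ?_, ?_, ?_, ?_, ?_, ?_, ?_⟩
  · have := hM.solvable
    exact Group.isSolvable_of_ker_le_range (inl : _ →* ModuleExtension ρ) rightHom
      range_inl_eq_ker_rightHom.ge
  · rw [SemidirectProduct.card]
    intro hdvd
    rcases (Nat.Prime.dvd_mul Fact.out).1 hdvd with hd | hd
    · have hd' : p ∣ Nat.card V := hd
      rw [Module.natCard_eq_pow_finrank (K := ZMod q), Nat.card_zmod] at hd'
      exact hpq ((Nat.prime_dvd_prime_iff_eq Fact.out Fact.out).1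
        (Nat.Prime.dvd_of_dvd_pow Fact.out hd'))
    · exact hM.not_dvd_card hd
  · have hσ : σ ^ p ^ n = 1 := by rw [← hM.orderOf_eq, pow_orderOf_eq_one]
    refine orderOf_eq_prime_pow (fun h1 => hv₀ (hfix v₀ ?_)) ?_
    · have := congrArg (fun e : MulAut (ModuleExtension ρ) => (e (incl ρ v₀)).left.toAdd) h1
      simpa [aut_pow_apply] using this
    · ext x
      · simp [aut_pow_apply, hτ]
      · simp [aut_pow_apply, show σ ^ p ^ (n + 1) = 1 by rw [pow_succ, pow_mul, hσ, one_pow]]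
  · intro x hx
    rw [aut_apply] at hx
    have hr : x.right = 1 := hM.eq_one_of_fixed _ (congrArg SemidirectProduct.right hx)
    have hl : τ x.left.toAdd = x.left.toAdd :=
      congrArg (fun y : ModuleExtension ρ => y.left.toAdd) hx
    -- A vector fixed by τ is fixed by τ^(p^n), which has no nonzero fixed vector.
    have hpow : ∀ k : ℕ, (τ ^ k) x.left.toAdd = x.left.toAdd := fun k => by
      induction k with
      | zero => rfl
      | succ k ih => rw [pow_succ, LinearEquiv.mul_apply, hl, ih]
    have hl0 := hfix _ (hpow _)
    ext
    · simpa using hl0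
    · exact hr
  · exact hM.height.succ_of_ker_eq rightHom rightHom_surjective hfit.symm
  · intro K hK hσ hne
    rw [hfit]
    exact (eq_bot_or_ker_le hρ h hirr K hK hσ).resolve_left hne
  · intro hbot
    rw [hfit] at hbot
    have : incl ρ v₀ ∈ (rightHom : ModuleExtension ρ →* M).ker := by simp [MonoidHom.mem_ker]
    rw [hbot, Subgroup.mem_bot, incl_eq_one] at this
    exact absurd this hv₀

end ModuleExtension

/-! ### Finding a faithful irreducible module without fixed vectors of T. -/

section InvariantSubmodule

variable {q : ℕ} {R M : Type*} [AddCommGroup R] [Module (ZMod q) R] [Group M]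

theorem Submodule.map_equiv_eq_of_forall_mem [Finite R] (e : R ≃ₗ[ZMod q] R) {W : Submodule (ZMod q) R}
    (h : ∀ v ∈ W, e v ∈ W) : W.map (e : R →ₗ[ZMod q] R) = W := by
  apply SetLike.coe_injective
  refine Set.eq_of_subset_of_ncard_le ?_ ?_ (Set.toFinite _)
  · rintro _ ⟨v, hv, rfl⟩
    exact h v hv
  · rw [Submodule.map_coe]
    exact (Set.ncard_image_of_injective _ e.injective).ge

/-- A nonzero invariant submodule of a finite module contains an irreducible one. -/
theorem exists_irreducible_le [Finite R] (ρ : M →* (R ≃ₗ[ZMod q] R)) (τ : R ≃ₗ[ZMod q] R)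
    (U : Submodule (ZMod q) R) (hU : U ≠ ⊥) (hUρ : ∀ m, ∀ v ∈ U, ρ m v ∈ U)
    (hUτ : ∀ v ∈ U, τ v ∈ U) :
    ∃ (V : Submodule (ZMod q) R) (ρ' : M →* (V ≃ₗ[ZMod q] V)) (τ' : V ≃ₗ[ZMod q] V),
      V ≤ U ∧ V ≠ ⊥ ∧ (∀ m v, (ρ' m v : R) = ρ m v) ∧ (∀ v, (τ' v : R) = τ v) ∧
      ∀ W : Submodule (ZMod q) V, (∀ m, ∀ v ∈ W, ρ' m v ∈ W) → (∀ v ∈ W, τ' v ∈ W) →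
        W = ⊥ ∨ W = ⊤ := by
  obtain ⟨V, ⟨⟨hVU, hV, hVρ, hVτ⟩, hmin⟩⟩ := exists_minimal_of_wellFoundedLT
    (fun V : Submodule (ZMod q) R => V ≤ U ∧ V ≠ ⊥ ∧ (∀ m, ∀ v ∈ V, ρ m v ∈ V) ∧
      ∀ v ∈ V, τ v ∈ V) ⟨U, le_rfl, hU, hUρ, hUτ⟩
  let ρ' : M →* (V ≃ₗ[ZMod q] V) :=
    { toFun := fun m => (ρ m).ofSubmodules V V (Submodule.map_equiv_eq_of_forall_mem _ (hVρ m))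
      map_one' := by ext v; simp
      map_mul' := fun a b => by ext v; simp }
  let τ' : V ≃ₗ[ZMod q] V :=
    τ.ofSubmodules V V (Submodule.map_equiv_eq_of_forall_mem _ hVτ)
  refine ⟨V, ρ', τ', hVU, hV, fun _ _ => rfl, fun _ => rfl, fun W hWρ hWτ => ?_⟩
  by_cases hW : W = ⊥
  · exact Or.inl hW
  right
  have hle : V ≤ W.map V.subtype := by
    refine hmin ⟨(Submodule.map_subtype_le V W).trans hVU, ?_, ?_, ?_⟩
      (Submodule.map_subtype_le V W)
    · intro h0
      apply hW
      rw [← Submodule.map_bot V.subtype] at h0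
      exact Submodule.map_injective_of_injective V.subtype_injective h0
    · rintro m _ ⟨w, hw, rfl⟩
      exact ⟨ρ' m w, hWρ m w hw, rfl⟩
    · rintro _ ⟨w, hw, rfl⟩
      exact ⟨τ' w, hWτ w hw, rfl⟩
  rw [eq_top_iff]
  rintro v -
  obtain ⟨w, hw, hwv⟩ := hle v.2
  rwa [← Subtype.ext hwv]

theorem pow_apply_semiconj {ρ : M →* (R ≃ₗ[ZMod q] R)} {τ : R ≃ₗ[ZMod q] R} {σ : MulAut M}
    (h : ∀ m v, τ (ρ m v) = ρ (σ m) (τ v)) (k : ℕ) (m : M) (v : R) :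
    (τ ^ k) (ρ m v) = ρ ((σ ^ k) m) ((τ ^ k) v) := by
  induction k with
  | zero => rfl
  | succ k ih =>
    rw [pow_succ', LinearEquiv.mul_apply, ih, h, pow_succ', MulAut.mul_apply,
      LinearEquiv.mul_apply]

theorem eq_zero_of_nsmul_eq_zero_of_coprime [Fact q.Prime] {k : ℕ} (hk : q.Coprime k) {v : R}
    (h : k • v = 0) : v = 0 := by
  rw [← Nat.cast_smul_eq_nsmul (ZMod q)] at h
  refine (smul_eq_zero.1 h).resolve_left fun h0 => ?_
  rw [ZMod.natCast_eq_zero_iff] at h0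
  exact (Nat.Prime.coprime_iff_not_dvd Fact.out).1 hk h0

/-- The hypotheses on f only serve to make the common kernel of the two sum operators nonzero. On a
vector fixed by T or by F(M) these operators act as p or |F(M)|, both invertible mod q. -/
theorem exists_faithful_irreducible [Finite R] {p n : ℕ} [Fact p.Prime] [Fact q.Prime] {σ : MulAut M}
    (hM : IsFittingTower p n M σ) (hq : q.Coprime (Nat.card M)) (hpq : p ≠ q)
    (ρ : M →* (R ≃ₗ[ZMod q] R)) (τ : R ≃ₗ[ZMod q] R)
    (h : ∀ m v, τ (ρ m v) = ρ (σ m) (τ v)) (hτ : τ ^ p ^ (n + 1) = 1) (f : R)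
    (hf : f - (τ ^ p ^ n) f ≠ 0)
    (hfρ : ∀ a, a ≠ 1 → (f - (τ ^ p ^ n) f) - ρ a (f - (τ ^ p ^ n) f) ≠ 0) :
    ∃ (V : Submodule (ZMod q) R) (ρ' : M →* (V ≃ₗ[ZMod q] V)) (τ' : V ≃ₗ[ZMod q] V),
      Nontrivial V ∧ Function.Injective ρ' ∧ (∀ m v, τ' (ρ' m v) = ρ' (σ m) (τ' v)) ∧
      (∀ W : Submodule (ZMod q) V, (∀ m, ∀ v ∈ W, ρ' m v ∈ W) → (∀ v ∈ W, τ' v ∈ W) →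
        W = ⊥ ∨ W = ⊤) ∧
      τ' ^ p ^ (n + 1) = 1 ∧ ∀ v, (τ' ^ p ^ n) v = v → v = 0 := by
  classical
  have := hM.finite
  have := Fintype.ofFinite M
  set T := τ ^ p ^ n with hT
  set A := fittingSubgroup M with hA
  have hAn : A.Normal := fittingSubgroup_normal M
  let S : Finset M := Finset.univ.filter (· ∈ A)
  have hS : ∀ a, a ∈ S ↔ a ∈ A := by simp [S]
  have hσn : σ ^ p ^ n = 1 := by rw [← hM.orderOf_eq, pow_orderOf_eq_one]
  have hTρ : ∀ (j : ℕ) m v, (T ^ j) (ρ m v) = ρ m ((T ^ j) v) := by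
    intro j m v
    rw [hT, ← pow_mul, pow_apply_semiconj h, pow_mul, hσn, one_pow, MulAut.one_apply]
  have hTτ : ∀ (j : ℕ) v, (T ^ j) (τ v) = τ ((T ^ j) v) := by
    intro j v
    rw [hT, ← pow_mul, ← LinearEquiv.mul_apply, ← LinearEquiv.mul_apply, ← pow_succ, pow_succ']
  have hTp : T ^ p = 1 := by rw [hT, ← pow_mul, ← pow_succ, hτ]
  have hσA : ∀ a, σ a ∈ A ↔ a ∈ A := fun a => by
    conv_rhs => rw [hA, ← fittingSubgroup_comap_equiv σ]
    rfl
  let EZ : R →ₗ[ZMod q] R := ∑ j ∈ Finset.range p, ((T ^ j : R ≃ₗ[ZMod q] R) : R →ₗ[ZMod q] R)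
  let EA : R →ₗ[ZMod q] R := ∑ a ∈ S, ((ρ a : R ≃ₗ[ZMod q] R) : R →ₗ[ZMod q] R)
  have hEZ : ∀ v, EZ v = ∑ j ∈ Finset.range p, (T ^ j) v := fun v => by simp [EZ]
  have hEA : ∀ v, EA v = ∑ a ∈ S, ρ a v := fun v => by simp [EA]
  have hEZρ : ∀ m v, EZ (ρ m v) = ρ m (EZ v) := fun m v => by simp [hEZ, hTρ]
  have hEZτ : ∀ v, EZ (τ v) = τ (EZ v) := fun v => by simp [hEZ, hTτ]
  have hEAρ : ∀ m v, EA (ρ m v) = ρ m (EA v) := by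
    intro m v
    rw [hEA, hEA, map_sum]
    refine Finset.sum_nbij' (fun a => m⁻¹ * a * m) (fun a => m * a * m⁻¹) ?_ ?_ ?_ ?_ ?_
    · intro a ha
      simpa [hS] using hAn.conj_mem a ((hS a).1 ha) m⁻¹
    · intro a ha
      simpa [hS] using hAn.conj_mem a ((hS a).1 ha) m
    · intro a _; group
    · intro a _; group
    · intro a _
      rw [← LinearEquiv.mul_apply, ← LinearEquiv.mul_apply, ← map_mul, ← map_mul]
      congr 2
      group
  have hEAτ : ∀ v, EA (τ v) = τ (EA v) := by
    intro v
    rw [hEA, hEA, map_sum]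
    symm
    refine Finset.sum_nbij' (fun a => σ a) (fun a => σ.symm a) ?_ ?_ ?_ ?_ ?_
    · intro a ha
      rwa [hS, hσA, ← hS]
    · intro a ha
      rwa [hS, ← hσA, MulEquiv.apply_symm_apply, ← hS]
    · intro a _; simp
    · intro a _; simp
    · intro a _; exact h a v
  -- The guard is needed when M is trivial: for A = 1 the operator `EA` is the identity, with zero
  -- kernel.
  let U : Submodule (ZMod q) R := LinearMap.ker EZ ⊓ ⨅ _ : A ≠ ⊥, LinearMap.ker EA
  have hU : ∀ v, v ∈ U ↔ EZ v = 0 ∧ (A ≠ ⊥ → EA v = 0) := fun v => by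
    simp [U, Submodule.mem_iInf]
  -- The sum telescopes to f - T^p f.
  have hg : EZ (f - T f) = 0 := by
    have h1 : ∀ j : ℕ, (T ^ j) (f - T f) = (T ^ j) f - (T ^ (j + 1)) f := fun j => by
      rw [map_sub, pow_succ, LinearEquiv.mul_apply]
    rw [hEZ, Finset.sum_congr rfl (fun j _ => h1 j), Finset.sum_range_sub', hTp, pow_zero, sub_self]
  have hUbot : U ≠ ⊥ := by
    rw [Submodule.ne_bot_iff]
    by_cases hAbot : A = ⊥
    · exact ⟨_, (hU _).2 ⟨hg, fun h0 => absurd hAbot h0⟩, hf⟩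
    · obtain ⟨a, ha, ha1⟩ := A.bot_or_exists_ne_one.resolve_left hAbot
      refine ⟨_, (hU _).2 ⟨?_, fun _ => ?_⟩, hfρ a ha1⟩
      · rw [map_sub, hEZρ, hg, map_zero, sub_zero]
      · rw [map_sub, sub_eq_zero, hEA, hEA]
        refine Finset.sum_nbij' (fun b => b * a⁻¹) (fun b => b * a) ?_ ?_ ?_ ?_ ?_
        · intro b hb
          exact (hS _).2 (A.mul_mem ((hS b).1 hb) (A.inv_mem ha))
        · intro b hb
          exact (hS _).2 (A.mul_mem ((hS b).1 hb) ha)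
        · intro b _; simp
        · intro b _; simp
        · intro b _
          rw [← LinearEquiv.mul_apply, ← map_mul, inv_mul_cancel_right]
  obtain ⟨V, ρ', τ', hVU, hV, hρ', hτ', hirr⟩ := exists_irreducible_le ρ τ U hUbot
    (fun m v hv => by
      rw [hU] at hv ⊢
      exact ⟨by rw [hEZρ, hv.1, map_zero], fun h0 => by rw [hEAρ, hv.2 h0, map_zero]⟩)
    (fun v hv => by
      rw [hU] at hv ⊢
      exact ⟨by rw [hEZτ, hv.1, map_zero], fun h0 => by rw [hEAτ, hv.2 h0, map_zero]⟩)
  have hVnt : Nontrivial V := Submodule.nontrivial_iff_ne_bot.2 hV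
  have hτ'pow : ∀ (k : ℕ) (v : V), ((τ' ^ k) v : R) = (τ ^ k) v := by
    intro k v
    induction k with
    | zero => rfl
    | succ k ih => rw [pow_succ', LinearEquiv.mul_apply, hτ', ih, pow_succ', LinearEquiv.mul_apply]
  have hcompat : ∀ m v, τ' (ρ' m v) = ρ' (σ m) (τ' v) := fun m v => by
    ext
    rw [hτ', hρ', h, hρ', hτ']
  refine ⟨V, ρ', τ', hVnt, ?_, hcompat, hirr, ?_, ?_⟩
  · rw [← MonoidHom.ker_eq_bot_iff]
    by_contra hker
    have hAker := hM.le_of_invariant ρ'.ker inferInstance (fun m hm => by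
      rw [MonoidHom.mem_ker] at hm ⊢
      ext v
      have := hcompat m (τ'.symm v)
      rw [hm, LinearEquiv.apply_symm_apply] at this
      simp [← this]) hker
    have hAbot : A ≠ ⊥ := fun h0 => by
      have := hM.subsingleton h0
      exact hker (Subsingleton.elim _ _)
    obtain ⟨v, hv⟩ := exists_ne (0 : V)
    refine hv (Subtype.ext ?_)
    refine eq_zero_of_nsmul_eq_zero_of_coprime
      (hq.coprime_dvd_right (Subgroup.card_subgroup_dvd_card A)) ?_
    have h1 := ((hU _).1 (hVU v.2)).2 hAbot
    have h2 : ∀ a ∈ S, ρ a (v : R) = v := fun a ha => by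
      rw [← hρ', MonoidHom.mem_ker.1 (hAker ((hS a).1 ha))]
      rfl
    rw [hEA, Finset.sum_congr rfl h2, Finset.sum_const] at h1
    rw [← h1]
    congr 1
    rw [Nat.card_eq_fintype_card, Fintype.card_subtype]
  · ext v
    rw [hτ'pow, hτ]
    rfl
  · intro v hv
    refine Subtype.ext (eq_zero_of_nsmul_eq_zero_of_coprime
      ((Nat.coprime_primes Fact.out Fact.out).2 hpq.symm) ?_)
    have h1 : T (v : R) = v := by rw [hT, ← hτ'pow, hv]
    have h2 : ∀ j : ℕ, (T ^ j) (v : R) = v := fun j => by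
      induction j with
      | zero => rfl
      | succ j ih => rw [pow_succ, LinearEquiv.mul_apply, h1, ih]
    have h3 := ((hU _).1 (hVU v.2)).1
    rw [hEZ, Finset.sum_congr rfl (fun j _ => h2 j), Finset.sum_const, Finset.card_range] at h3
    exact h3

end InvariantSubmodule

/-! ### The function space with its translation and shift operators. -/

section RegularModule

variable {q N : ℕ} {M : Type*} [Group M]

/-- Left translation on functions on `M × ZMod N`. -/
def translation (q N : ℕ) (M : Type*) [Group M] :
    M →* ((M × ZMod N → ZMod q) ≃ₗ[ZMod q] (M × ZMod N → ZMod q)) where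
  toFun m := LinearEquiv.funCongrLeft (ZMod q) (ZMod q)
    ((Equiv.mulLeft m⁻¹).prodCongr (Equiv.refl _))
  map_one' := by ext; simp [LinearEquiv.funCongrLeft_apply, LinearMap.funLeft_apply]
  map_mul' a b := by
    ext f ⟨x, i⟩
    simp [LinearEquiv.funCongrLeft_apply, LinearMap.funLeft_apply, mul_assoc]

theorem translation_apply (m : M) (f : M × ZMod N → ZMod q) (x : M) (i : ZMod N) :
    translation q N M m f (x, i) = f (m⁻¹ * x, i) := rfl

/-- The operator on functions on `M × ZMod N` that applies an automorphism of `M` and shifts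
`ZMod N` by one. -/
def shift (q N : ℕ) {M : Type*} [Group M] (σ : MulAut M) :
    (M × ZMod N → ZMod q) ≃ₗ[ZMod q] (M × ZMod N → ZMod q) :=
  LinearEquiv.funCongrLeft (ZMod q) (ZMod q) (σ.symm.toEquiv.prodCongr (Equiv.subRight 1))

theorem shift_apply (σ : MulAut M) (f : M × ZMod N → ZMod q) (x : M) (i : ZMod N) :
    shift q N σ f (x, i) = f (σ.symm x, i - 1) := rfl

theorem shift_pow_apply (σ : MulAut M) (f : M × ZMod N → ZMod q) (k : ℕ) (x : M) (i : ZMod N) :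
    (shift q N σ ^ k) f (x, i) = f ((σ ^ k).symm x, i - k) := by
  induction k generalizing x i with
  | zero => simp; rfl
  | succ k ih =>
    rw [pow_succ', LinearEquiv.mul_apply, shift_apply, ih, pow_succ']
    congr 2
    push_cast
    ring

theorem shift_translation (σ : MulAut M) (m : M) (f : M × ZMod N → ZMod q) :
    shift q N σ (translation q N M m f) = translation q N M (σ m) (shift q N σ f) := by
  ext ⟨x, i⟩
  simp [translation_apply, shift_apply]

end RegularModule

/-! ### The induction on height. -/

theorem IsFittingTower.exists_succ {p n : ℕ} [Fact p.Prime] {M : Type} [Group M] {σ : MulAut M}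
    (hM : IsFittingTower p n M σ) :
    ∃ (M' : Type) (_ : Group M') (σ' : MulAut M'), IsFittingTower p (n + 1) M' σ' := by
  classical
  have := hM.finite
  obtain ⟨q, hqle, hqp⟩ := Nat.exists_infinite_primes (p + Nat.card M + 1)
  have : Fact q.Prime := ⟨hqp⟩
  have hpp : p.Prime := Fact.out
  have hq : q.Coprime (Nat.card M) :=
    (Nat.Prime.coprime_iff_not_dvd hqp).2 fun hd => by
      have := Nat.le_of_dvd Nat.card_pos hd
      omega
  have hpq : p ≠ q := by omega
  have : NeZero (p ^ (n + 1)) := ⟨pow_ne_zero _ hpp.ne_zero⟩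
  have hσn : σ ^ p ^ n = 1 := by rw [← hM.orderOf_eq, pow_orderOf_eq_one]
  have hσn1 : σ ^ p ^ (n + 1) = 1 := by rw [pow_succ, pow_mul, hσn, one_pow]
  have hne : ((p ^ n : ℕ) : ZMod (p ^ (n + 1))) ≠ 0 := by
    rw [Ne, ZMod.natCast_eq_zero_iff, Nat.pow_dvd_pow_iff_le_right hpp.one_lt]
    omega
  -- For this delta function, T moves the support off the layer ZMod-coordinate 0, since p^n ≠ 0 mod
  -- p^(n+1). On that layer f - T f is the delta at 1, which no a ≠ 1 fixes.
  let f : M × ZMod (p ^ (n + 1)) → ZMod q := Pi.single (1, 0) 1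
  let T := shift q (p ^ (n + 1)) σ ^ p ^ n
  have hT : ∀ x i, T f (x, i) = f (x, i - (p ^ n : ℕ)) := fun x i => by
    rw [shift_pow_apply, hσn]
    rfl
  have hf : ∀ x, (f - T f) (x, 0) = if x = 1 then 1 else 0 := fun x => by
    rw [Pi.sub_apply, hT]
    simp only [f, Pi.single_apply, Prod.mk.injEq, zero_sub, neg_eq_zero, hne, and_false,
      and_true, if_false, sub_zero]
  obtain ⟨V, ρ, τ, hV, hρ, hcompat, hirr, hτ, hfix⟩ :=
    exists_faithful_irreducible hM hq hpq (translation q (p ^ (n + 1)) M)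
      (shift q (p ^ (n + 1)) σ) (shift_translation σ)
      (by
        ext g ⟨x, i⟩
        rw [shift_pow_apply, hσn1, ZMod.natCast_self, sub_zero]
        rfl) f
      (fun h0 => by
        have h1 := hf 1
        rw [h0, if_pos rfl] at h1
        exact zero_ne_one h1)
      (fun a ha h0 => by
        have h1 := congrFun h0 (1, 0)
        rw [Pi.sub_apply, translation_apply, mul_one, hf, hf] at h1
        simp [ha] at h1)
  exact ⟨_, _, _, ModuleExtension.isFittingTower_succ hM hρ hq hpq hcompat hirr hτ hfix⟩

theorem exists_isFittingTower (p : ℕ) [hp : Fact p.Prime] (n : ℕ) :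
    ∃ (M : Type) (_ : Group M) (σ : MulAut M), IsFittingTower p n M σ := by
  induction n with
  | zero => exact ⟨Unit, inferInstance, 1, isFittingTower_zero hp.out Unit⟩
  | succ n ih =>
    obtain ⟨M, _, σ, hM⟩ := ih
    exact hM.exists_succ

/-! ### Class sizes, minimal normality and the conclusion. -/

theorem SemidirectProduct.conj_inl {N G : Type*} [Group N] [Group G] {φ : G →* MulAut N}
    (g : N ⋊[φ] G) (x : N) :
    g * inl x * g⁻¹ = inl (g.left * φ g.right x * g.left⁻¹) := by
  ext <;> simp

/-- If a `p`-group acts without nontrivial fixed points, then `p` divides the sizes of all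
nontrivial conjugacy classes of the semidirect product inside the normal factor. -/
theorem dvd_index_centralizer_inl {p : ℕ} [Fact p.Prime] {H M : Type*} [Group H] [Group M]
    [Finite H] [Finite M] (φ : H →* MulAut M) (hH : IsPGroup p H)
    (hfix : ∀ m, (∀ h, φ h m = m) → m = 1) (x : M) (hx : x ≠ 1) :
    p ∣ (Subgroup.centralizer {(inl x : M ⋊[φ] H)}).index := by
  have : Finite (M ⋊[φ] H) := Finite.of_equiv _ equivProd.symm
  let C := Subgroup.centralizer {(inl x : M ⋊[φ] H)}
  let P : Subgroup (M ⋊[φ] H) := (inr : H →* M ⋊[φ] H).range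
  have hP : IsPGroup p P := hH.of_surjective _ (MonoidHom.rangeRestrict_surjective inr)
  have hcard := hP.card_modEq_card_fixedPoints ((M ⋊[φ] H) ⧸ C)
  -- A coset gC fixed by H means that H centralizes g x g⁻¹, an element of M, which is then trivial.
  have hempty : IsEmpty (MulAction.fixedPoints P ((M ⋊[φ] H) ⧸ C)) := by
    refine ⟨?_⟩
    rintro ⟨y, hy⟩
    obtain ⟨g, rfl⟩ := QuotientGroup.mk_surjective y
    apply hx
    have h1 : g.left * φ g.right x * g.left⁻¹ = 1 := by
      refine hfix _ fun h => ?_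
      have h2 : ((inr h * g : M ⋊[φ] H) : (M ⋊[φ] H) ⧸ C) = g := hy ⟨inr h, h, rfl⟩
      have h3 : g⁻¹ * (inr h * g) ∈ C := QuotientGroup.eq.1 h2.symm
      rw [Subgroup.mem_centralizer_singleton_iff] at h3
      apply inl_injective (φ := φ)
      rw [inl_aut, ← conj_inl]
      have h4 : inr h * (g * inl x * g⁻¹) = g * inl x * g⁻¹ * inr h := by
        have := congrArg (fun z => g * z * g⁻¹) h3
        simpa [mul_assoc] using this
      rw [h4, mul_assoc, ← map_mul, mul_inv_cancel, map_one, mul_one]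
    simpa [mul_inv_eq_one] using h1
  rw [Nat.card_of_isEmpty (α := MulAction.fixedPoints P ((M ⋊[φ] H) ⧸ C))] at hcard
  exact (Nat.modEq_zero_iff_dvd).1 hcard

/-- A group satisfying the inductive package has the Fitting subgroup as a minimal normal subgroup
of its extension by the cyclic group of automorphisms. -/
theorem IsFittingTower.isMinimalNormal {p n : ℕ} {M : Type*} [Group M] {σ : MulAut M}
    (hM : IsFittingTower p n M σ) (hn : 1 ≤ n) :
    IsMinimalNormal ((fittingSubgroup M).map
      (inl : M →* M ⋊[(Subgroup.zpowers σ).subtype] Subgroup.zpowers σ)) := by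
  have hnorm : (fittingSubgroup M).Normal := fittingSubgroup_normal M
  refine ⟨⟨?_⟩, ?_, ?_⟩
  · rintro _ ⟨m, hm, rfl⟩ g
    rw [conj_inl]
    refine ⟨_, hnorm.conj_mem _ ?_ _, rfl⟩
    have h1 := fittingSubgroup_comap_equiv ((Subgroup.zpowers σ).subtype g.right)
    rw [SetLike.mem_coe, ← h1] at hm
    exact hm
  · rw [Ne, Subgroup.map_eq_bot_iff_of_injective _ inl_injective]
    intro hbot
    have := hM.subsingleton hbot
    have h0 : n ≤ 0 := hM.height.2 (Subsingleton.elim _ _)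
    omega
  · intro K hK hle
    have hcomap : (K.comap inl).map inl = K :=
      Subgroup.map_comap_eq_self (hle.trans (Subgroup.map_le_range _ _))
    by_cases hbot : K.comap (inl : M →* M ⋊[(Subgroup.zpowers σ).subtype] Subgroup.zpowers σ) = ⊥
    · left
      rw [← hcomap, hbot, Subgroup.map_bot]
    · right
      refine le_antisymm hle ?_
      rw [Subgroup.map_le_iff_le_comap]
      refine hM.le_of_invariant _ (hK.comap _) (fun m hm => ?_) hbot
      have := hK.conj_mem _ hm (inr ⟨σ, Subgroup.mem_zpowers σ⟩)
      rw [← map_inv, ← inl_aut] at this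
      exact this

theorem mainTheorem5 (n : ℕ) (hn : 1 ≤ n) (p : ℕ) (hp : p.Prime) :
    ∃ (H M : Type) (_ : Group H) (_ : Group M) (φ : H →* MulAut M),
      -- `H` is cyclic of order `p ^ n` and acts faithfully on the finite group `M`
      IsCyclic H ∧ Nat.card H = p ^ n ∧ Function.Injective φ ∧ Finite M ∧
      -- `M` is a solvable `p'`-group of Fitting height `n`
      Group.IsSolvable M ∧ ¬ p ∣ Nat.card M ∧ HasFittingHeight M n ∧
      -- the Fitting subgroup of `M` is minimal normal in `G = M ⋊[φ] H`
      IsMinimalNormal ((fittingSubgroup M).map (SemidirectProduct.inl : M →* M ⋊[φ] H)) ∧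
      -- `p` divides `|G : C_G(x)|` for all nonidentity `x` in `M`
      ∀ x : M, x ≠ 1 →
        p ∣ (Subgroup.centralizer {(SemidirectProduct.inl x : M ⋊[φ] H)}).index := by
  have : Fact p.Prime := ⟨hp⟩
  obtain ⟨M, _, σ, hM⟩ := exists_isFittingTower p n
  have := hM.finite
  have hcard : Nat.card (Subgroup.zpowers σ) = p ^ n := by rw [Nat.card_zpowers, hM.orderOf_eq]
  have : Finite (MulAut M) := Finite.of_injective _ DFunLike.coe_injective
  refine ⟨Subgroup.zpowers σ, M, inferInstance, inferInstance, (Subgroup.zpowers σ).subtype,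
    inferInstance, hcard, Subgroup.subtype_injective _, hM.finite, hM.solvable, hM.not_dvd_card,
    hM.height, hM.isMinimalNormal hn, ?_⟩
  exact dvd_index_centralizer_inl _ (IsPGroup.of_card hcard) fun m hm =>
    hM.eq_one_of_fixed m (hm ⟨σ, Subgroup.mem_zpowers σ⟩)
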